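/- For a finite simple graph $G$, the distinguishing index $D'(G)$ is the least integer $d$ such that $G$ has an edge labeling (not necessarily a proper edge colouring) with $d$ labels for which the identity is the only automorphism of $G$ preserving the labels of all edges. The strong product $G\boxtimes H$ has vertex set $V(G)\times V(H)$, two distinct vertices $(g,h)$ and $(g',h')$ being adjacent if and only if ($g=g'$ or $gg'\in E(G)$) and ($h=h'$ or $hh'\in E(H)$). Let $P_n$ and $C_n$ denote the path and the cycle with $n$ vertices. Then: (i) $D'(P_m\boxtimes P_n)=2$ for all $m,n\ge 2$ with $(m,n)\ne(2,2)$, and $D'(P_2\boxtimes P_2)=3$; (ii) $D'(C_m\boxtimes C_n)=2$ for all $m,n\ge 3$; (iii) $D'(P_m\boxtimes C_n)=2$ for all $m\ge 2$ and $n\ge 3$. -/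

import Mathlib

namespace SimpleGraph

/-- The direct product of two graphs: `(g, h)` and `(g', h')` are adjacent precisely if
`g, g'` are adjacent in `G` and `h, h'` are adjacent in `H`. -/
def directProd {V W : Type*} (G : SimpleGraph V) (H : SimpleGraph W) : SimpleGraph (V × W) where
  Adj x y := G.Adj x.1 y.1 ∧ H.Adj x.2 y.2
  symm := ⟨fun _ _ h => ⟨h.1.symm, h.2.symm⟩⟩
  loopless := ⟨fun _ h => G.irrefl h.1⟩

/-- The strong product of two graphs: its edge set is the union of the edge sets of the
Cartesian (box) product and of the direct product. -/
def strongProd {V W : Type*} (G : SimpleGraph V) (H : SimpleGraph W) : SimpleGraph (V × W) :=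
  G.boxProd H ⊔ G.directProd H

/-- Two vertices of the strong product are adjacent iff they are distinct and, in each
coordinate, equal or adjacent. -/
theorem strongProd_adj {V W : Type*} (G : SimpleGraph V) (H : SimpleGraph W) (x y : V × W) :
    (G.strongProd H).Adj x y ↔
      x ≠ y ∧ (x.1 = y.1 ∨ G.Adj x.1 y.1) ∧ (x.2 = y.2 ∨ H.Adj x.2 y.2) := by
  obtain ⟨a, b⟩ := x
  obtain ⟨c, d⟩ := y
  have hG : G.Adj a c → a ≠ c := fun h => h.ne
  have hH : H.Adj b d → b ≠ d := fun h => h.ne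
  simp only [strongProd, directProd, sup_adj, boxProd_adj, ne_eq, Prod.mk.injEq]
  tauto

/-- An edge labeling (an arbitrary, not necessarily proper, edge colouring) is distinguishing
if the only automorphism of the graph that preserves the labels of all edges is the identity. -/
def IsDistinguishingEdgeLabeling {V L : Type*} (G : SimpleGraph V) (c : G.edgeSet → L) : Prop :=
  ∀ σ : G ≃g G, (∀ e : G.edgeSet, c (σ.mapEdgeSet e) = c e) → ∀ v : V, σ v = v

/-- The distinguishing index `D'(G)`: the least `d` such that `G` has a distinguishing edge
labeling with `d` labels. If there is no such `d`, the value is `⊤`. -/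
noncomputable def distinguishingIndex {V : Type*} (G : SimpleGraph V) : ℕ∞ :=
  ⨅ d ∈ {d : ℕ | ∃ c : G.edgeSet → Fin d, G.IsDistinguishingEdgeLabeling c}, (d : ℕ∞)

end SimpleGraph

namespace SimpleGraph

variable {V W : Type*}

/-! A graph with a nontrivial automorphism needs two labels, and two suffice once it has an
asymmetric spanning subgraph: mark that subgraph's edges
(`exists_isDistinguishingEdgeLabeling_of_asymmetric`). In a grid other than 2 by 2, traverse the
rows in alternating directions and add the diagonal at the first turn. The result is a Hamiltonian
path with one triangle, whose two tails have different positive lengths; it has no symmetry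
(`chordedRay_asymmetric`). Cycles contain paths, so the same subgraph serves all three families, and
reversing the first coordinate gives the nontrivial automorphism. The exception is the complete
graph on four vertices, where every 2-labeling has a symmetry (`exists_perm_preserving`). -/

theorem strongProd_mono {G G' : SimpleGraph V} {H H' : SimpleGraph W} (hG : G ≤ G')
    (hH : H ≤ H') : G.strongProd H ≤ G'.strongProd H' := by
  intro x y h
  rw [strongProd_adj] at h ⊢
  exact ⟨h.1, h.2.1.imp_right (@hG _ _), h.2.2.imp_right (@hH _ _)⟩

/-- An automorphism of the first factor induces one of the strong product. -/
def strongProdIsoLeft {G : SimpleGraph V} (φ : G ≃g G) (H : SimpleGraph W) :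
    G.strongProd H ≃g G.strongProd H where
  toEquiv := φ.toEquiv.prodCongr (Equiv.refl W)
  map_rel_iff' {x y} := by
    obtain ⟨a, b⟩ := x
    obtain ⟨c, d⟩ := y
    have h : G.Adj (φ a) (φ c) ↔ G.Adj a c := φ.map_adj_iff
    have h' : φ a = φ c ↔ a = c := φ.injective.eq_iff
    simp only [strongProd_adj, Equiv.prodCongr_apply, Prod.map, Equiv.refl_apply, ne_eq,
      Prod.mk.injEq, RelIso.coe_fn_toEquiv, h, h']

/-- The reversal of a path. -/
def pathGraphRev (n : ℕ) : pathGraph n ≃g pathGraph n where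
  toEquiv := Fin.revPerm
  map_rel_iff' {x y} := by
    simp only [pathGraph_adj, Fin.revPerm_apply, Fin.val_rev]
    omega

/-- A reflection of a cycle. -/
def cycleGraphRev (n : ℕ) : cycleGraph n ≃g cycleGraph n where
  toEquiv := Fin.revPerm
  map_rel_iff' {x y} := by
    have h : ∀ u v : Fin n, u.rev - v.rev = v - u := by
      intro u v
      ext
      simp only [Fin.val_sub, Fin.val_rev]
      congr 1
      omega
    simp only [cycleGraph_adj', Fin.revPerm_apply, h]
    exact or_comm

theorem two_le_of_isDistinguishingEdgeLabeling {G : SimpleGraph V} (φ : G ≃g G) {v : V}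
    (hv : φ v ≠ v) {d : ℕ} {c : G.edgeSet → Fin d} (hc : G.IsDistinguishingEdgeLabeling c) :
    2 ≤ d := by
  by_contra! hd
  have : Subsingleton (Fin d) := Fin.subsingleton_iff_le_one.2 (by omega)
  exact hv (hc φ (fun _ => Subsingleton.elim _ _) v)

theorem distinguishingIndex_eq {G : SimpleGraph V} {k : ℕ}
    (hk : ∃ c : G.edgeSet → Fin k, G.IsDistinguishingEdgeLabeling c)
    (h : ∀ d : ℕ, ∀ c : G.edgeSet → Fin d, G.IsDistinguishingEdgeLabeling c → k ≤ d) :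
    G.distinguishingIndex = k := by
  refine le_antisymm (iInf₂_le k hk) (le_iInf₂ fun d hd => ?_)
  obtain ⟨c, hc⟩ := hd
  exact_mod_cast h d c hc

/-- Labeling the edges of an asymmetric spanning subgraph differently from the others is
distinguishing. -/
theorem exists_isDistinguishingEdgeLabeling_of_asymmetric {G H : SimpleGraph V} (hle : H ≤ G)
    (hH : ∀ σ : H ≃g H, ∀ v, σ v = v) :
    ∃ c : G.edgeSet → Fin 2, G.IsDistinguishingEdgeLabeling c := by
  classical
  refine ⟨fun e => if e.1 ∈ H.edgeSet then 1 else 0, fun σ hσ => ?_⟩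
  have key : ∀ x y, H.Adj (σ x) (σ y) ↔ H.Adj x y := by
    intro x y
    by_cases hxy : G.Adj x y
    · have h := hσ ⟨s(x, y), hxy⟩
      simp only [Iso.mapEdgeSet, Equiv.coe_fn_mk, Hom.mapEdgeSet, Sym2.map_mk, mem_edgeSet] at h
      by_cases h1 : H.Adj x y <;> by_cases h2 : H.Adj (σ x) (σ y) <;> simp_all
    · exact iff_of_false (fun h => hxy (σ.map_adj_iff.1 (hle h))) (fun h => hxy (hle h))
  exact hH ⟨σ.toEquiv, key _ _⟩

theorem distinguishingIndex_eq_two {G H : SimpleGraph V} (hle : H ≤ G)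
    (hH : ∀ σ : H ≃g H, ∀ v, σ v = v) (φ : G ≃g G) {v : V} (hv : φ v ≠ v) :
    G.distinguishingIndex = 2 :=
  distinguishingIndex_eq (exists_isDistinguishingEdgeLabeling_of_asymmetric hle hH)
    fun _ _ hc => two_le_of_isDistinguishingEdgeLabeling φ hv hc

/-! ### Asymmetry of a path with one triangle -/

/-- The one-way infinite path with the additional edge `{a, a + 2}`. -/
def chordedRay (a : ℕ) : SimpleGraph ℕ where
  Adj i j := i + 1 = j ∨ j + 1 = i ∨ (i = a ∧ j = a + 2) ∨ (j = a ∧ i = a + 2)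
  symm := ⟨fun _ _ h => by omega⟩
  loopless := ⟨fun _ h => by omega⟩

theorem chordedRay_triangle {a x y z : ℕ} (hxy : (chordedRay a).Adj x y)
    (hyz : (chordedRay a).Adj y z) (hxz : (chordedRay a).Adj x z) :
    a ≤ x ∧ x ≤ a + 2 ∧ a ≤ y ∧ y ≤ a + 2 ∧ a ≤ z ∧ z ≤ a + 2 := by
  simp only [chordedRay] at hxy hyz hxz
  rcases hxy with h | h | h | h <;> rcases hyz with h' | h' | h' | h' <;> omega

/-- A finite path with an additional edge closing a triangle is asymmetric if the triangle splits
it into parts of different positive lengths. -/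
theorem chordedRay_asymmetric {a N : ℕ} (ha : 1 ≤ a) (hN : 2 * a + 3 < N) (s t : ℕ → ℕ)
    (ht : ∀ i < N, t i < N) (hst : ∀ i < N, s (t i) = i)
    (hinj : ∀ i < N, ∀ j < N, s i = s j → i = j)
    (hadj : ∀ i < N, ∀ j < N, (chordedRay a).Adj (s i) (s j) ↔ (chordedRay a).Adj i j) :
    ∀ i < N, s i = i := by
  have fwd : ∀ i j, i < N → j < N → (chordedRay a).Adj i j → (chordedRay a).Adj (s i) (s j) :=
    fun i j hi hj => (hadj i hi j hj).2
  have ne : ∀ i j, i < N → j < N → i ≠ j → s i ≠ s j :=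
    fun i j hi hj h h' => h (hinj i hi j hj h')
  have pull : ∀ i < N, ∀ j < N, (chordedRay a).Adj (s i) j →
      ∃ k < N, s k = j ∧ (chordedRay a).Adj i k := by
    intro i hi j hj h
    refine ⟨t j, ht j hj, hst j hj, ?_⟩
    rw [← hadj i hi (t j) (ht j hj), hst j hj]
    exact h
  have tri := chordedRay_triangle
    (fwd a (a + 1) (by omega) (by omega) (by simp [chordedRay]))
    (fwd (a + 1) (a + 2) (by omega) (by omega) (by simp [chordedRay]))
    (fwd a (a + 2) (by omega) (by omega) (by simp [chordedRay]))
  have ne01 := ne a (a + 1) (by omega) (by omega) (by omega)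
  have ne12 := ne (a + 1) (a + 2) (by omega) (by omega) (by omega)
  have ne02 := ne a (a + 2) (by omega) (by omega) (by omega)
  simp only [chordedRay] at fwd pull
  clear hadj hst hinj ht
  -- Both other corners of the triangle have a neighbour outside it, by `ha` and `hN`; the middle
  -- one has none.
  have hmid : s (a + 1) = a + 1 := by
    by_contra hne
    have hcase : s (a + 1) = a ∨ s (a + 1) = a + 2 := by omega
    have no : ∀ k, (a + 1 + 1 = k ∨ k + 1 = a + 1 ∨ a + 1 = a ∧ k = a + 2 ∨
        k = a ∧ a + 1 = a + 2) → k = a ∨ k = a + 2 := by omega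
    rcases hcase with h | h
    · obtain ⟨k, hk, hsk, hk'⟩ := pull (a + 1) (by omega) (a - 1) (by omega) (by omega)
      rcases no k hk' with rfl | rfl <;> omega
    · obtain ⟨k, hk, hsk, hk'⟩ := pull (a + 1) (by omega) (a + 3) (by omega) (by omega)
      rcases no k hk' with rfl | rfl <;> omega
  have hcase : (s a = a ∧ s (a + 2) = a + 2) ∨ (s a = a + 2 ∧ s (a + 2) = a) := by omega
  have fwdLeft0 := fwd (a - 1) a (by omega) (by omega) (by omega)
  have neLeft1 := ne (a - 1) (a + 1) (by omega) (by omega) (by omega)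
  have neLeft2 := ne (a - 1) (a + 2) (by omega) (by omega) (by omega)
  have fwdLeft : ∀ k, k + 2 ≤ a → _ := fun k hk =>
    fwd (a - (k + 2)) (a - (k + 1)) (by omega) (by omega) (by omega)
  have neLeft : ∀ k, k + 2 ≤ a → _ := fun k hk =>
    ne (a - (k + 2)) (a - k) (by omega) (by omega) (by omega)
  have fwdRight0 := fwd (a + 2 + 1) (a + 2) (by omega) (by omega) (by omega)
  have neRight1 := ne (a + 2 + 1) (a + 1) (by omega) (by omega) (by omega)
  have neRight2 := ne (a + 2 + 1) a (by omega) (by omega) (by omega)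
  have fwdRight : ∀ k, a + 2 + (k + 2) < N → _ := fun k hk =>
    fwd (a + 2 + (k + 2)) (a + 2 + (k + 1)) (by omega) (by omega) (by omega)
  have neRight : ∀ k, a + 2 + (k + 2) < N → _ := fun k hk =>
    ne (a + 2 + (k + 2)) (a + 2 + k) (by omega) (by omega) (by omega)
  clear fwd ne tri
  rcases hcase with ⟨h0, h2⟩ | ⟨h0, h2⟩
  -- Along a tail, each image is adjacent to the previous one and differs from the one before that,
  -- which leaves one choice.
  · have left : ∀ k ≤ a, s (a - k) = a - k := by
      intro k
      induction k using Nat.twoStepInduction with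
      | zero => exact fun _ => h0
      | one => intro _; omega
      | more k ih ih' =>
        intro hk
        have h1 := ih (by omega)
        have h2 := ih' (by omega)
        have h3 := fwdLeft k hk
        have h4 := neLeft k hk
        omega
    have right : ∀ k, a + 2 + k < N → s (a + 2 + k) = a + 2 + k := by
      intro k
      induction k using Nat.twoStepInduction with
      | zero => exact fun _ => h2
      | one => intro _; omega
      | more k ih ih' =>
        intro hk
        have h1 := ih (by omega)
        have h2 := ih' (by omega)
        have h3 := fwdRight k hk
        have h4 := neRight k hk
        omega
    intro i hi
    rcases le_or_gt i a with h | h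
    · simpa [Nat.sub_sub_self h] using left (a - i) (by omega)
    · rcases eq_or_lt_of_le (Nat.succ_le_of_lt h) with h | h
      · simpa [← h] using hmid
      · obtain ⟨k, rfl⟩ := Nat.exists_eq_add_of_le (Nat.succ_le_of_lt h)
        exact right k hi
  · exfalso
    have left : ∀ k ≤ a, s (a - k) = a + 2 + k := by
      intro k
      induction k using Nat.twoStepInduction with
      | zero => exact fun _ => h0
      | one => intro _; omega
      | more k ih ih' =>
        intro hk
        have h1 := ih (by omega)
        have h2 := ih' (by omega)
        have h3 := fwdLeft k hk
        have h4 := neLeft k hk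
        omega
    have e0 := left a le_rfl
    have e1 := left (a - 1) (by omega)
    rw [Nat.sub_self] at e0
    rw [Nat.sub_sub_self ha] at e1
    -- The short tail would end at `2 * a + 2`, but the long tail goes on to `2 * a + 3`, and the
    -- only neighbour of `0` is already sent to `2 * a + 1`.
    obtain ⟨k, hk, hsk, hk'⟩ := pull 0 (by omega) (2 * a + 3) (by omega) (by omega)
    obtain rfl : k = 1 := by omega
    omega

theorem comap_chordedRay_asymmetric {a N : ℕ} (ha : 1 ≤ a) (hN : 2 * a + 3 < N) (e : V ≃ Fin N)
    (σ : (chordedRay a).comap (fun v => (e v : ℕ)) ≃g (chordedRay a).comap (fun v => (e v : ℕ)))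
    (v : V) : σ v = v := by
  have key := chordedRay_asymmetric ha hN
    (fun i => if h : i < N then (e (σ (e.symm ⟨i, h⟩)) : ℕ) else i)
    (fun i => if h : i < N then (e (σ.symm (e.symm ⟨i, h⟩)) : ℕ) else i)
    (fun i hi => by simp [hi]) (fun i hi => by simp [hi])
    (fun i hi j hj h => by simpa [hi, hj, Fin.val_inj] using h)
    (fun i hi j hj => by
      have := σ.map_adj_iff (v := e.symm ⟨i, hi⟩) (w := e.symm ⟨j, hj⟩)
      simpa [hi, hj] using this)
    (e v) (e v).2
  simpa [Fin.val_inj] using key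

/-! ### The boustrophedon path in the grid -/

/-- The position of a cell of the `m` by `n` grid when the rows are traversed in alternating
directions. -/
def snake (n r c : ℕ) : ℕ := r * n + if r % 2 = 0 then c else n - 1 - c

theorem snake_lt {m n r c : ℕ} (hr : r < m) (hc : c < n) : snake n r c < m * n := by
  have : (r + 1) * n ≤ m * n := Nat.mul_le_mul_right n hr
  rw [add_mul, one_mul] at this
  unfold snake
  split_ifs <;> omega

theorem snake_div {n r c : ℕ} (hc : c < n) : snake n r c / n = r := by
  unfold snake
  rw [add_comm, Nat.add_mul_div_right _ _ (by omega), Nat.div_eq_of_lt, zero_add]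
  split_ifs <;> omega

theorem snake_inj {n r c r' c' : ℕ} (hc : c < n) (hc' : c' < n)
    (h : snake n r c = snake n r' c') : r = r' ∧ c = c' := by
  have hr : r = r' := by rw [← snake_div (r := r) hc, h, snake_div hc']
  subst hr
  unfold snake at h
  split_ifs at h <;> omega

/-- The boustrophedon enumeration of a grid. -/
noncomputable def snakeEquiv (m n : ℕ) : Fin m × Fin n ≃ Fin (m * n) :=
  Equiv.ofBijective (fun x => ⟨snake n x.1 x.2, snake_lt x.1.2 x.2.2⟩) <| by
    rw [Fintype.bijective_iff_injective_and_card]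
    refine ⟨fun x y h => ?_, by simp⟩
    have := snake_inj x.2.2 y.2.2 (Fin.val_eq_of_eq h)
    exact Prod.ext (Fin.ext this.1) (Fin.ext this.2)

theorem snake_succ {n r c r' c' : ℕ} (hc : c < n) (hc' : c' < n)
    (h : snake n r c + 1 = snake n r' c') :
    (r = r' ∧ (c + 1 = c' ∨ c' + 1 = c)) ∨ (r + 1 = r' ∧ c = c') := by
  have h1 := snake_div (r := r) hc
  have h2 := snake_div (r := r') hc'
  rw [← h, Nat.succ_div, h1] at h2
  split_ifs at h2 with hd <;> clear hd h1
  · subst h2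
    right
    unfold snake at h
    rw [add_mul, one_mul] at h
    split_ifs at h <;> omega
  · rw [add_zero] at h2
    subst h2
    left
    unfold snake at h
    split_ifs at h <;> omega

theorem snake_eq_sub_two {n r c : ℕ} (hn : 3 ≤ n) (hc : c < n) (h : snake n r c = n - 2) :
    r = 0 ∧ c = n - 2 := by
  exact snake_inj (r' := 0) (c' := n - 2) hc (by omega) (by simpa [snake] using h)

theorem snake_eq_self {n r c : ℕ} (hn : 3 ≤ n) (hc : c < n) (h : snake n r c = n) :
    r = 1 ∧ c = n - 1 :=
  snake_inj (r' := 1) (c' := n - 1) hc (by omega) (by simpa [snake] using h)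

/-- The chord joins the cells `(0, n - 2)` and `(1, n - 1)`; it is the only diagonal edge used. -/
theorem comap_snake_le {m n : ℕ} (hn : 3 ≤ n) :
    (chordedRay (n - 2)).comap (fun x : Fin m × Fin n => (snakeEquiv m n x : ℕ)) ≤
      (pathGraph m).strongProd (pathGraph n) := by
  rintro ⟨r, c⟩ ⟨r', c'⟩ h
  have hne := h.ne
  rw [strongProd_adj]
  refine ⟨hne, ?_⟩
  have e : n - 2 + 2 = n := by omega
  simp only [comap_adj, chordedRay, snakeEquiv, Equiv.ofBijective_apply, e] at h
  simp only [pathGraph_adj, Fin.ext_iff]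
  rcases h with h | h | ⟨h, h'⟩ | ⟨h, h'⟩
  · have := snake_succ c.2 c'.2 h
    omega
  · have := snake_succ c'.2 c.2 h
    omega
  · have := snake_eq_sub_two hn c.2 h
    have := snake_eq_self hn c'.2 h'
    omega
  · have := snake_eq_sub_two hn c'.2 h
    have := snake_eq_self hn c.2 h'
    omega

theorem exists_asymmetric_le_strongProd_pathGraph {m n : ℕ} (hm : 2 ≤ m) (hn : 2 ≤ n)
    (hmn : ¬ (m = 2 ∧ n = 2)) :
    ∃ H ≤ (pathGraph m).strongProd (pathGraph n), ∀ σ : H ≃g H, ∀ v, σ v = v := by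
  have size : ∀ {k l : ℕ}, 2 ≤ k → 3 ≤ l → 2 * (l - 2) + 3 < k * l := by
    intro k l hk hl
    have := Nat.mul_le_mul_right l hk
    omega
  by_cases h : 3 ≤ n
  · exact ⟨_, comap_snake_le h, comap_chordedRay_asymmetric (by omega) (size hm h) _⟩
  -- With two columns the chord would start at the end of the path, so the grid is transposed.
  · have h : 3 ≤ m := by omega
    refine ⟨_, ?_, comap_chordedRay_asymmetric (a := m - 2) (by omega) (size hn h)
      ((Equiv.prodComm _ _).trans (snakeEquiv n m))⟩
    intro x y hxy
    have := comap_snake_le (m := n) h (v := x.swap) (w := y.swap) hxy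
    rw [strongProd_adj] at this ⊢
    exact ⟨fun e => this.1 (by rw [e]), this.2.2, this.2.1⟩

theorem strongProdIsoLeft_ne {m n : ℕ} (hm : 2 ≤ m) (hn : 2 ≤ n) {G : SimpleGraph (Fin m)}
    (φ : G ≃g G) (hφ : ∀ i, φ i = i.rev) (H : SimpleGraph (Fin n)) :
    strongProdIsoLeft φ H (⟨0, by omega⟩, ⟨0, by omega⟩) ≠ (⟨0, by omega⟩, ⟨0, by omega⟩) := by
  intro h
  have h : φ ⟨0, by omega⟩ = ⟨0, by omega⟩ := congrArg Prod.fst h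
  rw [hφ, Fin.ext_iff, Fin.val_rev] at h
  simp only at h
  omega

theorem distinguishingIndex_strongProd_eq_two {m n : ℕ} (hm : 2 ≤ m) (hn : 2 ≤ n)
    (hmn : ¬ (m = 2 ∧ n = 2)) {G : SimpleGraph (Fin m)} {H : SimpleGraph (Fin n)}
    (hG : pathGraph m ≤ G) (hH : pathGraph n ≤ H) (φ : G ≃g G) (hφ : ∀ i, φ i = i.rev) :
    (G.strongProd H).distinguishingIndex = 2 := by
  obtain ⟨K, hK, hK'⟩ := exists_asymmetric_le_strongProd_pathGraph hm hn hmn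
  exact distinguishingIndex_eq_two (hK.trans (strongProd_mono hG hH)) hK' _
    (strongProdIsoLeft_ne hm hn φ hφ H)

/-! ### The exceptional case: four mutually adjacent vertices -/

theorem strongProd_pathGraph_two :
    (pathGraph 2).strongProd (pathGraph 2) = (⊤ : SimpleGraph (Fin 2 × Fin 2)) := by
  ext x y
  rw [strongProd_adj, top_adj]
  simp only [pathGraph_adj, Fin.ext_iff]
  have := x.1.2
  have := x.2.2
  have := y.1.2
  have := y.2.2
  constructor
  · exact And.left
  · exact fun h => ⟨h, by omega, by omega⟩

theorem perm_preserves_of_values {L : Type*} {g : Fin 2 × Fin 2 → Fin 2 × Fin 2 → L}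
    (hg : ∀ x y, g x y = g y x) {σ : Equiv.Perm (Fin 2 × Fin 2)} {a b c d : Fin 2 × Fin 2}
    (ha : σ (0, 0) = a) (hb : σ (0, 1) = b) (hc : σ (1, 0) = c) (hd : σ (1, 1) = d)
    (hab : g a b = g (0, 0) (0, 1)) (hac : g a c = g (0, 0) (1, 0))
    (had : g a d = g (0, 0) (1, 1)) (hbc : g b c = g (0, 1) (1, 0))
    (hbd : g b d = g (0, 1) (1, 1)) (hcd : g c d = g (1, 0) (1, 1)) :
    ∀ x y, x ≠ y → g (σ x) (σ y) = g x y := by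
  simp only [Prod.forall, Fin.forall_fin_two, ha, hb, hc, hd]
  refine ⟨⟨⟨⟨?_, ?_⟩, ?_, ?_⟩, ⟨?_, ?_⟩, ?_, ?_⟩, ⟨⟨?_, ?_⟩, ?_, ?_⟩, ⟨?_, ?_⟩, ?_, ?_⟩ <;>
    intro hne <;>
    first
    | exact absurd rfl hne
    | assumption
    | exact (hg _ _).trans (Eq.trans (by assumption) (hg _ _))

set_option linter.unusedSimpArgs false in
/-- Every symmetric two-valued function on the pairs of four points is preserved by a nontrivial
permutation. -/
theorem exists_perm_preserving (g : Fin 2 × Fin 2 → Fin 2 × Fin 2 → Bool)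
    (hg : ∀ x y, g x y = g y x) :
    ∃ σ : Equiv.Perm (Fin 2 × Fin 2), (∃ v, σ v ≠ v) ∧
      ∀ x y, x ≠ y → g (σ x) (σ y) = g x y := by
  -- The alternatives are invariance under the six transpositions and the three double
  -- transpositions. A graph on four vertices has a pair of twins unless it is a path, which a
  -- double transposition reverses.
  have key : ∀ b₁ b₂ b₃ b₄ b₅ b₆ : Bool,
      (b₂ = b₄ ∧ b₃ = b₅) ∨ (b₁ = b₄ ∧ b₃ = b₆) ∨ (b₁ = b₅ ∧ b₂ = b₆) ∨
      (b₁ = b₂ ∧ b₅ = b₆) ∨ (b₁ = b₃ ∧ b₄ = b₆) ∨ (b₂ = b₃ ∧ b₄ = b₅) ∨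
      (b₂ = b₅ ∧ b₃ = b₄) ∨ (b₁ = b₆ ∧ b₃ = b₄) ∨ (b₁ = b₆ ∧ b₂ = b₅) := by decide
  have h10 := hg (0, 1) (0, 0)
  have h20 := hg (1, 0) (0, 0)
  have h30 := hg (1, 1) (0, 0)
  have h21 := hg (1, 0) (0, 1)
  have h31 := hg (1, 1) (0, 1)
  have h32 := hg (1, 1) (1, 0)
  rcases key (g (0, 0) (0, 1)) (g (0, 0) (1, 0)) (g (0, 0) (1, 1)) (g (0, 1) (1, 0))
    (g (0, 1) (1, 1)) (g (1, 0) (1, 1)) with h | h | h | h | h | h | h | h | h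
  · refine ⟨Equiv.swap (0, 0) (0, 1), ⟨(0, 0), by decide⟩,
      perm_preserves_of_values hg (a := (0, 1)) (b := (0, 0)) (c := (1, 0))
        (d := (1, 1)) (by decide) (by decide) (by decide) (by decide) ?_ ?_ ?_ ?_ ?_ ?_⟩ <;>
      simp only [h10, h20, h30, h21, h31, h32, h.1, h.2]
  · refine ⟨Equiv.swap (0, 0) (1, 0), ⟨(0, 0), by decide⟩,
      perm_preserves_of_values hg (a := (1, 0)) (b := (0, 1)) (c := (0, 0))
        (d := (1, 1)) (by decide) (by decide) (by decide) (by decide) ?_ ?_ ?_ ?_ ?_ ?_⟩ <;>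
      simp only [h10, h20, h30, h21, h31, h32, h.1, h.2]
  · refine ⟨Equiv.swap (0, 0) (1, 1), ⟨(0, 0), by decide⟩,
      perm_preserves_of_values hg (a := (1, 1)) (b := (0, 1)) (c := (1, 0))
        (d := (0, 0)) (by decide) (by decide) (by decide) (by decide) ?_ ?_ ?_ ?_ ?_ ?_⟩ <;>
      simp only [h10, h20, h30, h21, h31, h32, h.1, h.2]
  · refine ⟨Equiv.swap (0, 1) (1, 0), ⟨(0, 1), by decide⟩,
      perm_preserves_of_values hg (a := (0, 0)) (b := (1, 0)) (c := (0, 1))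
        (d := (1, 1)) (by decide) (by decide) (by decide) (by decide) ?_ ?_ ?_ ?_ ?_ ?_⟩ <;>
      simp only [h10, h20, h30, h21, h31, h32, h.1, h.2]
  · refine ⟨Equiv.swap (0, 1) (1, 1), ⟨(0, 1), by decide⟩,
      perm_preserves_of_values hg (a := (0, 0)) (b := (1, 1)) (c := (1, 0))
        (d := (0, 1)) (by decide) (by decide) (by decide) (by decide) ?_ ?_ ?_ ?_ ?_ ?_⟩ <;>
      simp only [h10, h20, h30, h21, h31, h32, h.1, h.2]
  · refine ⟨Equiv.swap (1, 0) (1, 1), ⟨(1, 0), by decide⟩,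
      perm_preserves_of_values hg (a := (0, 0)) (b := (0, 1)) (c := (1, 1))
        (d := (1, 0)) (by decide) (by decide) (by decide) (by decide) ?_ ?_ ?_ ?_ ?_ ?_⟩ <;>
      simp only [h10, h20, h30, h21, h31, h32, h.1, h.2]
  · refine ⟨Equiv.swap (0, 0) (0, 1) * Equiv.swap (1, 0) (1, 1), ⟨(0, 0), by decide⟩,
      perm_preserves_of_values hg (a := (0, 1)) (b := (0, 0)) (c := (1, 1))
        (d := (1, 0)) (by decide) (by decide) (by decide) (by decide) ?_ ?_ ?_ ?_ ?_ ?_⟩ <;>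
      simp only [h10, h20, h30, h21, h31, h32, h.1, h.2]
  · refine ⟨Equiv.swap (0, 0) (1, 0) * Equiv.swap (0, 1) (1, 1), ⟨(0, 0), by decide⟩,
      perm_preserves_of_values hg (a := (1, 0)) (b := (1, 1)) (c := (0, 0))
        (d := (0, 1)) (by decide) (by decide) (by decide) (by decide) ?_ ?_ ?_ ?_ ?_ ?_⟩ <;>
      simp only [h10, h20, h30, h21, h31, h32, h.1, h.2]
  · refine ⟨Equiv.swap (0, 0) (1, 1) * Equiv.swap (0, 1) (1, 0), ⟨(0, 0), by decide⟩,
      perm_preserves_of_values hg (a := (1, 1)) (b := (1, 0)) (c := (0, 1))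
        (d := (0, 0)) (by decide) (by decide) (by decide) (by decide) ?_ ?_ ?_ ?_ ?_ ?_⟩ <;>
      simp only [h10, h20, h30, h21, h31, h32, h.1, h.2]

theorem three_le_of_isDistinguishingEdgeLabeling_top {d : ℕ}
    {c : (⊤ : SimpleGraph (Fin 2 × Fin 2)).edgeSet → Fin d}
    (hc : IsDistinguishingEdgeLabeling _ c) : 3 ≤ d := by
  classical
  by_contra! hd
  -- With at most two labels, a label is determined by whether it is `0`.
  obtain ⟨σ, ⟨v, hv⟩, hσ⟩ := exists_perm_preserving
    (fun x y => if h : s(x, y) ∈ (⊤ : SimpleGraph (Fin 2 × Fin 2)).edgeSet then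
      decide ((c ⟨s(x, y), h⟩ : ℕ) = 0) else false)
    (fun x y => by simp only [Sym2.eq_swap (a := x)])
  refine hv (hc ⟨σ, by simp⟩ ?_ v)
  rintro ⟨e, he⟩
  induction e using Sym2.ind with
  | _ x y =>
    have hne : x ≠ y := he
    have he' : s(σ x, σ y) ∈ (⊤ : SimpleGraph (Fin 2 × Fin 2)).edgeSet :=
      fun h => hne (σ.injective h)
    have h := hσ x y hne
    rw [dif_pos he', dif_pos he, decide_eq_decide] at h
    change c ⟨s(σ x, σ y), he'⟩ = c ⟨s(x, y), he⟩
    ext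
    omega

theorem exists_isDistinguishingEdgeLabeling_top :
    ∃ c : (⊤ : SimpleGraph (Fin 2 × Fin 2)).edgeSet → Fin 3,
      IsDistinguishingEdgeLabeling _ c := by
  -- Two adjacent edges get private labels: their common vertex is fixed, hence so are their other
  -- ends and the remaining vertex.
  let f : Sym2 (Fin 2 × Fin 2) → Fin 3 := fun e =>
    if e = s((0, 0), (0, 1)) then 1 else if e = s((0, 1), (1, 0)) then 2 else 0
  have f1 : ∀ x y, f s(x, y) = 1 → s(x, y) = s((0, 0), (0, 1)) := by decide
  have f2 : ∀ x y, f s(x, y) = 2 → s(x, y) = s((0, 1), (1, 0)) := by decide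
  refine ⟨fun e => f e.1, fun σ hσ => ?_⟩
  have hf : ∀ x y, x ≠ y → f s(σ x, σ y) = f s(x, y) := fun x y h => hσ ⟨s(x, y), h⟩
  have h1 := f1 _ _ (hf (0, 0) (0, 1) (by decide))
  have h2 := f2 _ _ (hf (0, 1) (1, 0) (by decide))
  have h3 : σ (1, 1) ≠ σ (0, 0) := σ.injective.ne (by decide)
  have h4 : σ (1, 1) ≠ σ (0, 1) := σ.injective.ne (by decide)
  have h5 : σ (1, 1) ≠ σ (1, 0) := σ.injective.ne (by decide)
  have key : ∀ p q r t : Fin 2 × Fin 2, s(p, q) = s((0, 0), (0, 1)) →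
      s(q, r) = s((0, 1), (1, 0)) → t ≠ p → t ≠ q → t ≠ r →
      p = (0, 0) ∧ q = (0, 1) ∧ r = (1, 0) ∧ t = (1, 1) := by decide
  obtain ⟨k1, k2, k3, k4⟩ := key _ _ _ _ h1 h2 h3 h4 h5
  rintro ⟨x, y⟩
  fin_cases x <;> fin_cases y
  exacts [k1, k2, k3, k4]

theorem distinguishingIndex_strongProd_pathGraph_two :
    ((pathGraph 2).strongProd (pathGraph 2)).distinguishingIndex = 3 := by
  rw [strongProd_pathGraph_two]
  exact distinguishingIndex_eq exists_isDistinguishingEdgeLabeling_top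
    fun _ _ hc => three_le_of_isDistinguishingEdgeLabeling_top hc

end SimpleGraph

theorem mainTheorem7 :
    (∀ m n : ℕ, 2 ≤ m → 2 ≤ n → ¬ (m = 2 ∧ n = 2) →
      ((SimpleGraph.pathGraph m).strongProd (SimpleGraph.pathGraph n)).distinguishingIndex = 2) ∧
    ((SimpleGraph.pathGraph 2).strongProd (SimpleGraph.pathGraph 2)).distinguishingIndex = 3 ∧
    (∀ m n : ℕ, 3 ≤ m → 3 ≤ n →
      ((SimpleGraph.cycleGraph m).strongProd (SimpleGraph.cycleGraph n)).distinguishingIndex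
        = 2) ∧
    (∀ m n : ℕ, 2 ≤ m → 3 ≤ n →
      ((SimpleGraph.pathGraph m).strongProd (SimpleGraph.cycleGraph n)).distinguishingIndex
        = 2) := by
  refine ⟨fun m n hm hn hmn => ?_, SimpleGraph.distinguishingIndex_strongProd_pathGraph_two,
    fun m n hm hn => ?_, fun m n hm hn => ?_⟩
  · exact SimpleGraph.distinguishingIndex_strongProd_eq_two hm hn hmn le_rfl le_rfl
      (SimpleGraph.pathGraphRev m) fun _ => rfl
  · exact SimpleGraph.distinguishingIndex_strongProd_eq_two (by omega) (by omega) (by omega)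
      SimpleGraph.pathGraph_le_cycleGraph SimpleGraph.pathGraph_le_cycleGraph
      (SimpleGraph.cycleGraphRev m) fun _ => rfl
  · exact SimpleGraph.distinguishingIndex_strongProd_eq_two hm (by omega) (by omega)
      le_rfl SimpleGraph.pathGraph_le_cycleGraph (SimpleGraph.pathGraphRev m) fun _ => rfl
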